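/- A partition with designated summands of weight $m$ is an integer partition of $m$ in which, for each part size that occurs, exactly one of the occurrences of that part is designated (marked). Let $PD_2(m)$ denote the number of partitions with designated summands of weight $m$ in which no part is divisible by $2$, i.e., all parts are odd. Then for all integers $\alpha \ge 0$ and $n \ge 0$, $$PD_2\bigl(2^\alpha(8n+7)\bigr) \equiv 0 \pmod{8}.$$ -/

import Mathlib

/-- The `k`-regular partitions of `n` with designated summands: a partition of `n` none of whose
parts is divisible by `k`, together with, for every part size `i` that occurs in it, a choice of
exactly one of the occurrences of `i` (an element of `Fin c`, where `c` is the multiplicity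
of `i`). -/
abbrev RegularDesignatedPartition (k n : ℕ) : Type :=
  Σ μ : {μ : n.Partition // ∀ i ∈ μ.parts, ¬ k ∣ i},
    (i : {i : ℕ // i ∈ μ.1.parts.toFinset}) → Fin (μ.1.parts.count i.1)

/-- `PD k n` is the number of `k`-regular partitions of `n` with designated summands. -/
def PD (k n : ℕ) : ℕ := Fintype.card (RegularDesignatedPartition k n)

/-!
The generating function `P` of `PD 2` is the product of `(1 - xⁱ + x²ⁱ) / (1 - xⁱ)²` over odd `i`.
Over a ring containing a root `w` of `w² + w + 1`, the numerator is `(1 + w xⁱ) (1 + w⁻¹ xⁱ)`, so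
the Jacobi triple product, applied to `w` and to `-1`, gives `θ(-1) P = θ(w)`, where `θ(w)` is the
sum of `wʲ x^(j²)` over all integers `j`. Now `θ(-1) = 2 τ - 1` with `τ = ∑ (-1)ⁿ x^(n²)` over
`n ≥ 0`, and `4 τ² = 4 σ` modulo `8` with `σ = ∑ x^(2n²)`, so that `P = -θ(w) (1 + 2 τ + 4 σ)`
modulo `8`. Every exponent on the right is of the form `a² + b²` or `a² + 2 b²`; neither form
represents `2 ^ α * (8 * n + 7)`, since it does not represent `8 * n + 7` and represents `m`
whenever it represents `2 m`.
-/

open Filter Finset PowerSeries Topology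

section QAnalogues

variable {S : Type*} [CommRing S]

/-- The `q`-Pochhammer symbol `(q; q)_m`. -/
def qPochhammer (q : S) (m : ℕ) : S := ∏ i ∈ range m, (1 - q ^ (i + 1))

/-- The Gaussian binomial coefficient `[m choose k]` at `q`, defined by the `q`-Pascal rule
so that it makes sense in every ring. -/
def qChoose (q : S) : ℕ → ℕ → S
  | _, 0 => 1
  | 0, _ + 1 => 0
  | m + 1, k + 1 => qChoose q m k + q ^ (k + 1) * qChoose q m (k + 1)

@[simp]
lemma qPochhammer_zero (q : S) : qPochhammer q 0 = 1 := rfl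

lemma qPochhammer_succ (q : S) (m : ℕ) :
    qPochhammer q (m + 1) = qPochhammer q m * (1 - q ^ (m + 1)) :=
  prod_range_succ _ _

@[simp]
lemma qChoose_zero_right (q : S) (m : ℕ) : qChoose q m 0 = 1 := by
  cases m <;> rfl

lemma qChoose_succ_succ (q : S) (m k : ℕ) :
    qChoose q (m + 1) (k + 1) = qChoose q m k + q ^ (k + 1) * qChoose q m (k + 1) := rfl

lemma qChoose_eq_zero_of_lt (q : S) {m k : ℕ} (h : m < k) : qChoose q m k = 0 := by
  induction m generalizing k with
  | zero => obtain ⟨k, rfl⟩ := Nat.exists_eq_add_one_of_ne_zero h.ne'; rfl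
  | succ m ih =>
    obtain ⟨k, rfl⟩ := Nat.exists_eq_add_one_of_ne_zero (Nat.ne_zero_of_lt h)
    rw [qChoose_succ_succ, ih (by omega), ih (by omega), mul_zero, add_zero]

@[simp]
lemma qChoose_self (q : S) (m : ℕ) : qChoose q m m = 1 := by
  induction m with
  | zero => rfl
  | succ m ih =>
    rw [qChoose_succ_succ, ih, qChoose_eq_zero_of_lt q m.lt_succ_self, mul_zero, add_zero]

lemma qChoose_add_mul_qPochhammer_mul_qPochhammer (q : S) (j k : ℕ) :
    qChoose q (j + k) j * qPochhammer q j * qPochhammer q k = qPochhammer q (j + k) := by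
  induction j generalizing k with
  | zero => simp
  | succ j ihj =>
    induction k with
    | zero => simp
    | succ k ihk =>
      have hj := ihj (k + 1)
      rw [add_right_comm] at ihk
      rw [add_add_add_comm, ← add_assoc, qChoose_succ_succ, qPochhammer_succ q (j + k + 1)]
      rw [← add_assoc] at hj
      simp only [qPochhammer_succ q j, qPochhammer_succ q k] at hj ihk ⊢
      linear_combination (1 - q ^ (j + 1)) * hj + q ^ (j + 1) * (1 - q ^ (k + 1)) * ihk

lemma sum_qChoose_succ_mul (q : S) (m : ℕ) (f : ℕ → S) :
    ∑ k ∈ range (m + 2), qChoose q (m + 1) k * f k =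
      ∑ k ∈ range (m + 1), qChoose q m k * (f (k + 1) + q ^ k * f k) := by
  have hshift : ∑ k ∈ range (m + 1), q ^ k * qChoose q m k * f k =
      f 0 + ∑ k ∈ range (m + 1), q ^ (k + 1) * qChoose q m (k + 1) * f (k + 1) := by
    rw [sum_range_succ', sum_range_succ _ m, qChoose_eq_zero_of_lt q m.lt_succ_self]
    simp [add_comm]
  rw [sum_range_succ', qChoose_zero_right, one_mul]
  simp only [qChoose_succ_succ, mul_add, add_mul, sum_add_distrib]
  rw [add_assoc, add_comm _ (f 0), ← hshift]
  simp only [mul_assoc, mul_left_comm]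

lemma q_binomial_theorem (q z : S) (m : ℕ) :
    ∏ i ∈ range m, (1 + z * q ^ i) =
      ∑ k ∈ range (m + 1), qChoose q m k * (q ^ k.choose 2 * z ^ k) := by
  induction m generalizing z with
  | zero => simp
  | succ m ih =>
    have hshift : ∀ i, 1 + z * q ^ (i + 1) = 1 + z * q * q ^ i := fun i ↦ by ring
    rw [sum_qChoose_succ_mul, prod_range_succ']
    simp only [hshift, ih, sum_mul]
    refine sum_congr rfl fun k _ ↦ ?_
    rw [Nat.choose_succ_succ' k 1, Nat.choose_one_right]
    ring

lemma two_mul_choose_two_add_self (k : ℕ) : 2 * k.choose 2 + k = k ^ 2 := by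
  rw [Nat.choose_two_right, Nat.mul_div_cancel' (Nat.even_mul_pred_self k).two_dvd]
  cases k <;> grind

lemma finite_triple_product (q w : S) (a b : ℕ) :
    (∏ i ∈ range a, (1 + w * q ^ (2 * i + 1))) * ∏ i ∈ range b, (w + q ^ (2 * i + 1)) =
      ∑ k ∈ range (a + b + 1),
        qChoose (q ^ 2) (a + b) k * (w ^ k * q ^ ((k - b : ℤ).natAbs ^ 2)) := by
  induction b with
  | zero =>
    have hpow (i : ℕ) : 1 + w * q ^ (2 * i + 1) = 1 + w * q * (q ^ 2) ^ i := by ring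
    simp only [hpow, prod_range_zero, mul_one, q_binomial_theorem]
    refine sum_congr rfl fun k _ ↦ ?_
    have hexp : 2 * k.choose 2 + k = ((k : ℤ) - (0 : ℕ)).natAbs ^ 2 := by
      simpa using two_mul_choose_two_add_self k
    rw [add_zero, ← hexp]
    ring
  | succ b ih =>
    rw [prod_range_succ, ← mul_assoc, ih, ← add_assoc, sum_qChoose_succ_mul, sum_mul]
    refine sum_congr rfl fun k _ ↦ ?_
    have hshift : ((k + 1 : ℕ) - (b + 1 : ℕ) : ℤ) = k - b := by push_cast; ring
    have hexp : (k - b : ℤ).natAbs ^ 2 + (2 * b + 1) =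
        2 * k + (k - (b + 1 : ℕ) : ℤ).natAbs ^ 2 := by
      zify
      simp only [sq_abs]
      ring
    rw [hshift, ← pow_mul, mul_left_comm (q ^ (2 * k)), ← pow_add, ← hexp]
    ring

lemma isCoprime_pow_qPochhammer (q : S) (m n : ℕ) : IsCoprime (q ^ n) (qPochhammer q m) := by
  refine .pow_left (.prod_right fun i _ ↦ ⟨q ^ i, 1, ?_⟩)
  ring

lemma pow_succ_dvd_qPochhammer_sub_qPochhammer (q : S) {m j k : ℕ} (hj : m ≤ j) (hk : m ≤ k) :
    q ^ (m + 1) ∣ qPochhammer q j - qPochhammer q k := by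
  have hdvd : ∀ l, m ≤ l → q ^ (m + 1) ∣ qPochhammer q l - qPochhammer q m := fun l hl ↦ by
    induction l, hl using Nat.le_induction with
    | base => simp
    | succ l hl ih =>
      rw [qPochhammer_succ, mul_one_sub, sub_right_comm]
      exact dvd_sub ih ((pow_dvd_pow q (by omega)).mul_left _)
  simpa using dvd_sub (hdvd j hj) (hdvd k hk)

lemma pow_succ_dvd_qPochhammer_mul_qChoose_sub_one (q : S) {m n j k : ℕ}
    (hn : m ≤ n) (hj : m ≤ j) (hk : m ≤ k) :
    q ^ (m + 1) ∣ qPochhammer q n * qChoose q (j + k) j - 1 := by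
  have hcop := (isCoprime_pow_qPochhammer q j (m + 1)).mul_right
    (isCoprime_pow_qPochhammer q k (m + 1))
  refine hcop.dvd_of_dvd_mul_left ?_
  have hadd := pow_succ_dvd_qPochhammer_sub_qPochhammer q (hj.trans (j.le_add_right k)) hj
  have hsub := pow_succ_dvd_qPochhammer_sub_qPochhammer q hn hk
  convert dvd_add (hadd.mul_left (qPochhammer q n)) (hsub.mul_left (qPochhammer q j)) using 1
  linear_combination qPochhammer q n * qChoose_add_mul_qPochhammer_mul_qPochhammer q j k

lemma pow_dvd_triple_product_sub_sum_range (q w : S) (n : ℕ) :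
    q ^ (2 * n + 1) ∣
      qPochhammer (q ^ 2) n * ∏ l ∈ range n, ((1 + w * q ^ (2 * l + 1)) * (w + q ^ (2 * l + 1))) -
      ∑ k ∈ range (2 * n + 1), w ^ k * q ^ ((k - n : ℤ).natAbs ^ 2) := by
  rw [prod_mul_distrib, finite_triple_product, ← two_mul, mul_sum, ← sum_sub_distrib]
  refine dvd_sum fun k hk ↦ ?_
  obtain ⟨j, hj⟩ : ∃ j, k + j = 2 * n := ⟨2 * n - k, by have := mem_range.1 hk; omega⟩
  set d := (k - n : ℤ).natAbs
  have hmin : n = min k j + d := by omega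
  have hdvd : q ^ (2 * (min k j + 1)) ∣ qPochhammer (q ^ 2) n * qChoose (q ^ 2) (2 * n) k - 1 := by
    rw [pow_mul, ← hj]
    exact pow_succ_dvd_qPochhammer_mul_qChoose_sub_one (q ^ 2) (by omega)
      (min_le_left k j) (min_le_right k j)
  have hexp : 2 * n + 1 ≤ 2 * (min k j + 1) + d ^ 2 := by
    zify at hmin ⊢
    nlinarith [sq_nonneg ((d : ℤ) - 1)]
  refine (pow_dvd_pow q hexp).trans ?_
  rw [pow_add]
  convert (mul_dvd_mul hdvd (dvd_refl (q ^ d ^ 2))).mul_left (w ^ k) using 1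
  ring

lemma sum_Icc_neg_eq_sum_range {M : Type*} [AddCommMonoid M] (f : ℤ → M) (n : ℕ) :
    ∑ j ∈ Icc (-n : ℤ) n, f j = ∑ k ∈ range (2 * n + 1), f (k - n) := by
  have hcard : ((n : ℤ) + 1 + n).toNat = 2 * n + 1 := by omega
  simp [Int.Icc_eq_finset_map, hcard, neg_add_eq_sub]

lemma pow_dvd_triple_product_sub_sum_Icc (q : S) (w : Sˣ) (n : ℕ) :
    q ^ (2 * n + 1) ∣
      ∏ l ∈ range n,
        ((1 - q ^ (2 * l + 2)) * ((1 + w * q ^ (2 * l + 1)) * (1 + ↑w⁻¹ * q ^ (2 * l + 1)))) -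
      ∑ j ∈ Icc (-n : ℤ) n, ↑(w ^ j) * q ^ (j.natAbs ^ 2) := by
  have hprod : (w : S) ^ n * ∏ l ∈ range n,
        ((1 - q ^ (2 * l + 2)) * ((1 + w * q ^ (2 * l + 1)) * (1 + ↑w⁻¹ * q ^ (2 * l + 1)))) =
      qPochhammer (q ^ 2) n *
        ∏ l ∈ range n, ((1 + w * q ^ (2 * l + 1)) * (w + q ^ (2 * l + 1))) := by
    nth_rw 1 [qPochhammer, ← prod_mul_distrib, ← card_range n]
    rw [pow_card_mul_prod]
    refine prod_congr rfl fun l _ ↦ ?_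
    linear_combination (1 - q ^ (2 * l + 2)) * (1 + w * q ^ (2 * l + 1)) * q ^ (2 * l + 1) *
      w.mul_inv
  have hsum : (w : S) ^ n * ∑ j ∈ Icc (-n : ℤ) n, ↑(w ^ j) * q ^ (j.natAbs ^ 2) =
      ∑ k ∈ range (2 * n + 1), (w : S) ^ k * q ^ ((k - n : ℤ).natAbs ^ 2) := by
    rw [sum_Icc_neg_eq_sum_range, mul_sum]
    refine sum_congr rfl fun k _ ↦ ?_
    rw [← mul_assoc, ← Units.val_pow_eq_pow_val, ← Units.val_pow_eq_pow_val, ← Units.val_mul,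
      ← zpow_natCast w n, ← zpow_add, add_sub_cancel, zpow_natCast]
  rw [← (w.isUnit.pow n).dvd_mul_left, mul_sub, hprod, hsum]
  exact pow_dvd_triple_product_sub_sum_range q w n

end QAnalogues

open scoped PowerSeries.WithPiTopology

section SparseSeries

variable {R : Type*} [CommRing R]

lemma tendsto_order_C_mul_X_pow (c : ℕ → R) {e : ℕ → ℕ} (he : Tendsto e atTop atTop) :
    Tendsto (fun n ↦ (C (c n) * X ^ e n : R⟦X⟧).order) atTop (𝓝 ⊤) := by
  rw [ENat.tendsto_nhds_top_iff_natCast_lt]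
  intro d
  filter_upwards [he.eventually_gt_atTop d] with n hn
  calc (d : ℕ∞) < e n := by exact_mod_cast hn
    _ ≤ (C (c n) * X ^ e n : R⟦X⟧).order :=
      le_order _ _ fun i hi ↦ by
        rw [coeff_C_mul_X_pow, if_neg]
        rintro rfl
        exact lt_irrefl _ hi

variable [TopologicalSpace R]

lemma summable_C_mul_X_pow (c : ℕ → R) {e : ℕ → ℕ} (he : Tendsto e atTop atTop) :
    Summable fun n ↦ (C (c n) * X ^ e n : R⟦X⟧) :=
  WithPiTopology.summable_of_tendsto_order_atTop_nhds_top R (tendsto_order_C_mul_X_pow c he)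

lemma multipliable_one_add_C_mul_X_pow (c : ℕ → R) {e : ℕ → ℕ} (he : Tendsto e atTop atTop) :
    Multipliable fun n ↦ (1 + C (c n) * X ^ e n : R⟦X⟧) :=
  WithPiTopology.multipliable_one_add_of_tendsto_order_atTop_nhds_top R
    (tendsto_order_C_mul_X_pow c he)

variable [T2Space R]

lemma coeff_eq_zero_of_hasSum {ι : Type*} {c : ι → R} {e : ι → ℕ} {f : R⟦X⟧}
    (hf : HasSum (fun i ↦ C (c i) * X ^ e i) f) {n : ℕ} (hn : ∀ i, e i ≠ n) : coeff n f = 0 := by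
  have hcoeff := (WithPiTopology.hasSum_iff_hasSum_coeff R).1 hf n
  simp only [coeff_C_mul_X_pow, if_neg (hn _).symm] at hcoeff
  exact hcoeff.unique hasSum_zero

lemma coeff_mul_eq_zero_of_hasSum {ι κ : Type*} {c : ι → R} {d : κ → R} {e : ι → ℕ} {e' : κ → ℕ}
    {f g : R⟦X⟧} (hf : HasSum (fun i ↦ C (c i) * X ^ e i) f)
    (hg : HasSum (fun k ↦ C (d k) * X ^ e' k) g) {n : ℕ} (hn : ∀ i k, e i + e' k ≠ n) :
    coeff n (f * g) = 0 := by
  rw [coeff_mul]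
  refine sum_eq_zero fun p hp ↦ ?_
  rw [HasAntidiagonal.mem_antidiagonal] at hp
  by_cases hi : ∃ i, e i = p.1
  · obtain ⟨i, hi⟩ := hi
    rw [coeff_eq_zero_of_hasSum hg fun k hk ↦ hn i k (by rw [hi, hk, hp]), mul_zero]
  · rw [coeff_eq_zero_of_hasSum hf (not_exists.1 hi), zero_mul]

end SparseSeries

lemma mul_sq_sum_eq_mul_sum_sq {S ι : Type*} [CommRing S] {c : S} (hc : 2 * c = 0)
    (s : Finset ι) (g : ι → S) : c * (∑ i ∈ s, g i) ^ 2 = c * ∑ i ∈ s, g i ^ 2 := by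
  classical
  induction s using Finset.induction_on with
  | empty => simp
  | insert a s ha ih =>
    rw [sum_insert ha, sum_insert ha]
    linear_combination ih + g a * (∑ i ∈ s, g i) * hc

lemma mul_sq_eq_mul_of_hasSum {S ι : Type*} [CommRing S] [TopologicalSpace S]
    [IsTopologicalSemiring S] [T2Space S] {c : S} (hc : 2 * c = 0) {g : ι → S} {a b : S}
    (ha : HasSum g a) (hb : HasSum (fun i ↦ g i ^ 2) b) : c * a ^ 2 = c * b := by
  refine tendsto_nhds_unique ((Tendsto.pow ha 2).const_mul c) ?_
  simp only [mul_sq_sum_eq_mul_sum_sq hc]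
  exact Tendsto.const_mul c hb

section JacobiTripleProduct

variable {R : Type*} [CommRing R] [TopologicalSpace R]

/-- The theta series `∑ wʲ X^(j²)` over all integers `j`. -/
noncomputable def thetaSeries (w : Rˣ) : R⟦X⟧ := ∑' j : ℤ, C ((w ^ j : Rˣ) : R) * X ^ (j.natAbs ^ 2)

lemma tendsto_of_X_pow_dvd_sub {f g : ℕ → R⟦X⟧} {a : R⟦X⟧} (hfg : ∀ n, X ^ n ∣ f n - g n)
    (hg : Tendsto g atTop (𝓝 a)) : Tendsto f atTop (𝓝 a) := by
  rw [WithPiTopology.tendsto_iff_coeff_tendsto] at hg ⊢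
  refine fun d ↦ (hg d).congr' ?_
  filter_upwards [eventually_gt_atTop d] with n hn
  exact (sub_eq_zero.1 (by rw [← map_sub, X_pow_dvd_iff.1 (hfg n) d hn])).symm

variable [IsTopologicalRing R]

lemma hasSum_thetaSeries (w : Rˣ) :
    HasSum (fun j : ℤ ↦ (C ((w ^ j : Rˣ) : R) * X ^ (j.natAbs ^ 2) : R⟦X⟧)) (thetaSeries w) := by
  have hsq : Tendsto (fun n : ℕ ↦ n ^ 2) atTop atTop := tendsto_pow_atTop two_ne_zero
  refine (Summable.of_nat_of_neg ?_ ?_).hasSum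
  · exact summable_C_mul_X_pow (fun n : ℕ ↦ ((w ^ (n : ℤ) : Rˣ) : R)) hsq
  · simpa only [Int.natAbs_neg, Int.natAbs_natCast] using!
      summable_C_mul_X_pow (fun n : ℕ ↦ ((w ^ (-n : ℤ) : Rˣ) : R)) hsq

lemma multipliable_triple_product (w : Rˣ) :
    Multipliable fun l : ℕ ↦ ((1 - X ^ (2 * l + 2)) *
      ((1 + C (w : R) * X ^ (2 * l + 1)) * (1 + C ((w⁻¹ : Rˣ) : R) * X ^ (2 * l + 1))) : R⟦X⟧) := by
  have he (r : ℕ) : Tendsto (fun l ↦ 2 * l + r) atTop atTop :=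
    tendsto_atTop_mono (fun l ↦ show l ≤ _ by omega) tendsto_id
  refine .mul ?_ (.mul ?_ ?_)
  · simpa only [map_neg, map_one, neg_one_mul, ← sub_eq_add_neg] using
      multipliable_one_add_C_mul_X_pow (fun _ ↦ (-1 : R)) (he 2)
  · exact multipliable_one_add_C_mul_X_pow (fun _ ↦ (w : R)) (he 1)
  · exact multipliable_one_add_C_mul_X_pow (fun _ ↦ ((w⁻¹ : Rˣ) : R)) (he 1)

variable [T2Space R]

lemma jacobi_triple_product (w : Rˣ) :
    HasProd (fun l : ℕ ↦ ((1 - X ^ (2 * l + 2)) *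
      ((1 + C (w : R) * X ^ (2 * l + 1)) * (1 + C ((w⁻¹ : Rˣ) : R) * X ^ (2 * l + 1))) : R⟦X⟧))
      (thetaSeries w) := by
  have hmul := (multipliable_triple_product w).hasProd
  have hsum := (hasSum_thetaSeries w).comp tendsto_Icc_neg
  have hdvd (n : ℕ) := (pow_dvd_pow X (by omega : n ≤ 2 * n + 1)).trans
    (pow_dvd_triple_product_sub_sum_Icc (X : R⟦X⟧) (Units.map C.toMonoidHom w) n)
  simp only [← map_zpow, ← map_inv] at hdvd
  have hlim := tendsto_of_X_pow_dvd_sub hdvd hsum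
  exact tendsto_nhds_unique hmul.tendsto_prod_nat hlim ▸ hmul

lemma thetaSeries_neg_one_add_one :
    thetaSeries (-1 : Rˣ) + 1 = 2 * ∑' n : ℕ, C ((-1 : R) ^ n) * X ^ (n ^ 2) := by
  have hτ := summable_C_mul_X_pow (fun n ↦ (-1 : R) ^ n) (tendsto_pow_atTop two_ne_zero)
  refine HasSum.unique ?_ (hτ.hasSum.mul_left 2)
  convert! (hasSum_thetaSeries (-1 : Rˣ)).nat_add_neg using 1
  · ext1 n
    simp [two_mul]
  · simp

end JacobiTripleProduct

section GeneratingFunction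

variable {R : Type*} [CommRing R]

lemma coeff_genFun_eq_cast_PD (k n : ℕ) :
    coeff n (Nat.Partition.genFun fun i c ↦ if k ∣ i then 0 else (c : R)) = PD k n := by
  classical
  rw [Nat.Partition.coeff_genFun, PD, Fintype.card_sigma, Nat.cast_sum,
    ← Fintype.sum_subtype_add_sum_subtype fun μ : n.Partition ↦ ∀ i ∈ μ.parts, ¬ k ∣ i]
  rw [sum_eq_zero (s := (univ : Finset {μ : n.Partition // ¬ _})), add_zero]
  · refine Fintype.sum_congr _ _ fun μ ↦ ?_
    rw [Fintype.card_pi, Nat.cast_prod, Finsupp.prod, Multiset.toFinsupp_support,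
      ← prod_coe_sort]
    refine Fintype.prod_congr _ _ fun i ↦ ?_
    simp [μ.2 i.1 (Multiset.mem_toFinset.1 i.2)]
  · rintro ⟨μ, hμ⟩ -
    push Not at hμ
    obtain ⟨i, hi, hki⟩ := hμ
    exact prod_eq_zero (i := i) (by simpa using hi) (by simp [hki])

variable [TopologicalSpace R]

variable (R) in
/-- The generating function of the partitions with designated summands all of whose parts
equal `i`. -/
noncomputable def designatedSeries (i : ℕ) : R⟦X⟧ :=
  1 + ∑' j : ℕ, ((j + 1 : ℕ) : R) • X ^ (i * (j + 1))

variable [T2Space R]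

lemma hasProd_designatedSeries (k : ℕ) :
    HasProd (fun i ↦ if k ∣ i + 1 then 1 else designatedSeries R (i + 1))
      (PowerSeries.mk fun n ↦ (PD k n : R)) := by
  have hgenFun : (PowerSeries.mk fun n ↦ (PD k n : R)) =
      Nat.Partition.genFun fun i c ↦ if k ∣ i then 0 else (c : R) := by
    ext n
    rw [coeff_mk, coeff_genFun_eq_cast_PD]
  rw [hgenFun]
  convert! Nat.Partition.hasProd_genFun fun i c ↦ if k ∣ i then 0 else (c : R) using 2 with i
  split_ifs <;> simp [designatedSeries]

lemma hasProd_designatedSeries_odd :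
    HasProd (fun l ↦ designatedSeries R (2 * l + 1)) (PowerSeries.mk fun n ↦ (PD 2 n : R)) := by
  have hinj : Function.Injective (2 * · : ℕ → ℕ) := mul_right_injective₀ two_ne_zero
  have heven (i : ℕ) (hi : i ∉ Set.range (2 * ·)) : 2 ∣ i + 1 := by
    contrapose! hi
    exact ⟨i / 2, by dsimp only; omega⟩
  have hodd (l : ℕ) : ¬ 2 ∣ 2 * l + 1 := by omega
  convert! (hinj.hasProd_iff fun i hi ↦ if_pos (heven i hi)).2
    (hasProd_designatedSeries (R := R) 2) using 2 with l
  rw [Function.comp_apply, if_neg (hodd l)]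

variable [IsTopologicalRing R]

lemma one_sub_X_pow_sq_mul_designatedSeries {i : ℕ} (hi : i ≠ 0) :
    (1 - X ^ i) ^ 2 * designatedSeries R i = 1 - X ^ i + X ^ (2 * i) := by
  have hG := Nat.Partition.summable_genFun_term' (fun _ _ ↦ (1 : R)) hi
  have hS := Nat.Partition.summable_genFun_term' (fun _ c ↦ (c : R)) hi
  rw [designatedSeries]
  simp only [one_smul] at hG
  set G : R⟦X⟧ := ∑' j : ℕ, X ^ (i * (j + 1)) with hGdef
  set S : R⟦X⟧ := ∑' j : ℕ, ((j + 1 : ℕ) : R) • X ^ (i * (j + 1)) with hSdef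
  have hgeometric : G = X ^ i + X ^ i * G := by
    have hterm (j : ℕ) : (X : R⟦X⟧) ^ (i * (j + 1 + 1)) = X ^ i * X ^ (i * (j + 1)) := by ring
    nth_rw 1 [hGdef]
    rw [hG.tsum_eq_zero_add, tsum_congr hterm, hG.tsum_mul_left, zero_add, mul_one]
  have harithmetic : S = X ^ i + X ^ i * (S + G) := by
    have hterm (j : ℕ) : ((j + 1 + 1 : ℕ) : R) • (X : R⟦X⟧) ^ (i * (j + 1 + 1)) =
        X ^ i * (((j + 1 : ℕ) : R) • X ^ (i * (j + 1)) + X ^ (i * (j + 1))) := by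
      simp only [smul_eq_C_mul, map_natCast]
      push_cast
      ring
    nth_rw 1 [hSdef]
    rw [hS.tsum_eq_zero_add, tsum_congr hterm, (hS.add hG).tsum_mul_left, hS.tsum_add hG, zero_add,
      mul_one, Nat.cast_one, one_smul]
  linear_combination (1 - X ^ i) * harithmetic + X ^ i * hgeometric

lemma thetaSeries_neg_one_mul_mk_PD {w : Rˣ} (hw : (w : R) ^ 2 + w + 1 = 0) :
    thetaSeries (-1) * PowerSeries.mk (fun n ↦ (PD 2 n : R)) = thetaSeries w := by
  refine ((jacobi_triple_product (-1)).mul hasProd_designatedSeries_odd).unique ?_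
  convert! jacobi_triple_product w using 2 with l
  have hinv : C (w : R) + C ((w⁻¹ : Rˣ) : R) = -1 := by
    rw [← map_add, show (w : R) + ↑w⁻¹ = -1 by
      linear_combination ↑w⁻¹ * hw - (w + 1) * w.mul_inv, map_neg, map_one]
  have hmul : C (w : R) * C ((w⁻¹ : Rˣ) : R) = 1 := by rw [← map_mul, w.mul_inv, map_one]
  have hfactor := one_sub_X_pow_sq_mul_designatedSeries (R := R) (i := 2 * l + 1) (by omega)
  simp only [inv_neg, inv_one, Units.val_neg, Units.val_one, map_neg, map_one]
  linear_combination (1 - X ^ (2 * l + 2)) *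
    (hfactor - X ^ (2 * l + 1) * hinv - (X ^ (2 * l + 1)) ^ 2 * hmul)

end GeneratingFunction

section Arithmetic

lemma sq_add_sq_ne_two_pow_mul (α n : ℕ) (a b : ℤ) : a ^ 2 + b ^ 2 ≠ 2 ^ α * (8 * n + 7) := by
  induction α generalizing a b with
  | zero =>
    have hmod : ∀ a b : ZMod 8, a ^ 2 + b ^ 2 ≠ 8 * n + 7 := by
      rw [show (8 : ZMod 8) = 0 from rfl, zero_mul]
      decide
    exact fun h ↦ hmod a b (by simpa using congrArg (Int.cast : ℤ → ZMod 8) h)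
  | succ α ih =>
    intro h
    exact ih _ _ (Int.sq_add_sq_of_two_mul_sq_add_sq (by rw [h]; ring)).symm

lemma sq_add_two_mul_sq_ne_two_pow_mul (α n : ℕ) (a b : ℤ) :
    a ^ 2 + 2 * b ^ 2 ≠ 2 ^ α * (8 * n + 7) := by
  induction α generalizing a b with
  | zero =>
    have hmod : ∀ a b : ZMod 8, a ^ 2 + 2 * b ^ 2 ≠ 8 * n + 7 := by
      rw [show (8 : ZMod 8) = 0 from rfl, zero_mul]
      decide
    exact fun h ↦ hmod a b (by simpa using congrArg (Int.cast : ℤ → ZMod 8) h)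
  | succ α ih =>
    intro h
    rw [pow_succ' 2 α, mul_assoc] at h
    have heven : 2 ∣ a := Int.prime_two.dvd_of_dvd_pow ((Int.dvd_add_left ⟨b ^ 2, rfl⟩).1 ⟨_, h⟩)
    obtain ⟨c, rfl⟩ := heven
    exact ih b c (by linarith)

end Arithmetic

section Congruence

variable {R : Type*} [CommRing R]

lemma mk_PD_two_eq [TopologicalSpace R] [IsTopologicalRing R] [T2Space R] (h8 : (8 : R) = 0)
    {w : Rˣ} (hw : (w : R) ^ 2 + w + 1 = 0) :
    PowerSeries.mk (fun n ↦ (PD 2 n : R)) = -(thetaSeries w +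
      2 • (thetaSeries w * ∑' n : ℕ, C ((-1 : R) ^ n) * X ^ (n ^ 2)) +
      4 • (thetaSeries w * ∑' n : ℕ, C (1 : R) * X ^ (2 * n ^ 2))) := by
  have h8' : (8 : R⟦X⟧) = 0 := by rw [← map_ofNat C 8, h8, map_zero]
  have hτ := (summable_C_mul_X_pow (fun n ↦ (-1 : R) ^ n) (tendsto_pow_atTop two_ne_zero)).hasSum
  have hσ := (summable_C_mul_X_pow (fun _ ↦ (1 : R)) (e := fun n ↦ 2 * n ^ 2)
    ((tendsto_pow_atTop two_ne_zero).const_mul_atTop' two_pos)).hasSum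
  have hterm (n : ℕ) : (C ((-1 : R) ^ n) * X ^ n ^ 2) ^ 2 = C (1 : R) * X ^ (2 * n ^ 2) := by
    rw [mul_pow, ← map_pow, pow_right_comm, neg_one_sq, one_pow, ← pow_mul, mul_comm 2]
  have hsq := mul_sq_eq_mul_of_hasSum (c := 4) (by linear_combination h8') hτ
    (by simpa only [hterm] using! hσ)
  have hθ := thetaSeries_neg_one_add_one (R := R)
  have hP := thetaSeries_neg_one_mul_mk_PD hw
  set P := PowerSeries.mk fun n ↦ (PD 2 n : R)
  set τ : R⟦X⟧ := ∑' n : ℕ, C ((-1 : R) ^ n) * X ^ (n ^ 2)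
  rw [nsmul_eq_mul, nsmul_eq_mul, ← hP, eq_sub_of_add_eq hθ]
  push_cast
  linear_combination τ ^ 3 * P * h8' - (2 * τ - 1) * P * hsq

lemma cast_PD_two_eq_zero (h8 : (8 : R) = 0) {w : R} (hw : w ^ 2 + w + 1 = 0) {N : ℕ}
    (hsum : ∀ a b : ℕ, a ^ 2 + b ^ 2 ≠ N) (hsum_two : ∀ a b : ℕ, a ^ 2 + 2 * b ^ 2 ≠ N) :
    (PD 2 N : R) = 0 := by
  let _ : TopologicalSpace R := ⊥
  have : DiscreteTopology R := ⟨rfl⟩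
  obtain ⟨w, rfl⟩ : IsUnit w := .of_mul_eq_one (w ^ 2) (by linear_combination (w - 1) * hw)
  have hsq : Tendsto (fun n : ℕ ↦ n ^ 2) atTop atTop := tendsto_pow_atTop two_ne_zero
  have hθ := hasSum_thetaSeries w
  have hcoeff := congrArg (coeff N) (mk_PD_two_eq h8 hw)
  rw [coeff_mk] at hcoeff
  rw [hcoeff, map_neg, map_add, map_add, map_nsmul, map_nsmul,
    coeff_eq_zero_of_hasSum hθ fun j ↦ by simpa using hsum j.natAbs 0,
    coeff_mul_eq_zero_of_hasSum hθ (summable_C_mul_X_pow _ hsq).hasSum fun j n ↦ hsum j.natAbs n,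
    coeff_mul_eq_zero_of_hasSum hθ
      (summable_C_mul_X_pow _ (hsq.const_mul_atTop' two_pos)).hasSum fun j n ↦ hsum_two j.natAbs n]
  simp

theorem theorem2_general {N : ℕ} (hsum : ∀ a b : ℕ, a ^ 2 + b ^ 2 ≠ N)
    (hsum_two : ∀ a b : ℕ, a ^ 2 + 2 * b ^ 2 ≠ N) : PD 2 N ≡ 0 [MOD 8] := by
  have h8 : (8 : QuadraticAlgebra (ZMod 8) (-1) (-1)) = 0 := by ext <;> rfl
  have hω : (⟨0, 1⟩ : QuadraticAlgebra (ZMod 8) (-1) (-1)) ^ 2 + ⟨0, 1⟩ + 1 = 0 := by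
    ext <;> rfl
  rw [← ZMod.natCast_eq_natCast_iff]
  simpa using congrArg QuadraticAlgebra.re (cast_PD_two_eq_zero h8 hω hsum hsum_two)

end Congruence

theorem theorem2 (α n : ℕ) : PD 2 (2 ^ α * (8 * n + 7)) ≡ 0 [MOD 8] :=
  theorem2_general (fun a b h ↦ sq_add_sq_ne_two_pow_mul α n a b (by exact_mod_cast h))
    fun a b h ↦ sq_add_two_mul_sq_ne_two_pow_mul α n a b (by exact_mod_cast h)
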